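/- Let $g \ge 0$ and $i \geq 3$ be integers, let $S_g$ be the complex vector space of symmetric complex $g\times g$ matrices, and let $\mathcal H_g \subset S_g$ be the Siegel upper half space, i.e. the open subset of symmetric matrices with positive definite imaginary part; thus $T_A\mathcal H_g = S_g$ for every $A \in \mathcal H_g$. For a linear subspace $W \subset \mathbb C^g$ put $W^\perp := \{M \in S_g : Mw = 0 \text{ for all } w \in W\}$. Let $X \subset \mathcal H_g$ be an irreducible closed complex analytic subvariety (a closed complex analytic subset whose set of smooth points is nonempty and connected) of dimension $\frac{i(i-1)}{2}$. Suppose that for every smooth point $A$ of $X$ there is given a linear subspace $W(A) \subset \mathbb C^g$ of dimension $g-i+1$ such that $$T_A X = W(A)^{\perp} \subset T_A\mathcal H_g = S_g .$$ Then $W(A) = W$ is independent of the smooth point $A$, and there is a $\tau \in \mathcal H_g$ such that $$X = \{M \in \mathcal H_g : Mw = \tau w \text{ for all } w \in W\}.$$ -/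

import Mathlib

/-! Finite-dimensional matrix spaces carry the entrywise sup norm; only the topology and the
resulting notion of holomorphic function matter below. -/

attribute [local instance] Matrix.normedAddCommGroup Matrix.normedSpace

namespace SiegelSlice

section AnalyticSets

variable {E : Type*} [NormedAddCommGroup E] [NormedSpace ℂ E]

/-- `X` is a closed complex analytic subset of the open set `Ω`: around every point of `Ω`
(not only of `X`) it is the common zero locus of finitely many holomorphic functions. -/
def IsAnalyticSubset (Ω X : Set E) : Prop :=
  X ⊆ Ω ∧ ∀ p ∈ Ω, ∃ U : Set E, IsOpen U ∧ p ∈ U ∧ U ⊆ Ω ∧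
    ∃ (k : ℕ) (f : Fin k → E → ℂ), (∀ j, AnalyticOnNhd ℂ (f j) U) ∧
      X ∩ U = {x ∈ U | ∀ j, f j x = 0}

/-- `A` is a smooth point of `X`, and `T` is the tangent space of `X` at `A`: near `A`, the set
`X` is the zero locus of a holomorphic map `F` to some `ℂ ^ m` whose derivative at `A` is
surjective (so `X` is a complex submanifold near `A`), and `T` is the kernel of that derivative.
The space `T` does not depend on `F`, see `IsSmoothPointWithTangent.unique`. -/
def IsSmoothPointWithTangent (X : Set E) (A : E) (T : Submodule ℂ E) : Prop :=
  A ∈ X ∧ ∃ U : Set E, IsOpen U ∧ A ∈ U ∧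
    ∃ (m : ℕ) (F : E → Fin m → ℂ), AnalyticOnNhd ℂ F U ∧
      X ∩ U = {x ∈ U | F x = 0} ∧
      Function.Surjective (fderiv ℂ F A) ∧
      T = LinearMap.ker (fderiv ℂ F A : E →ₗ[ℂ] (Fin m → ℂ))

/-- The set of smooth points of `X`. -/
def smoothLocus (X : Set E) : Set E :=
  {A | ∃ T, IsSmoothPointWithTangent X A T}

/-- `X` is an (irreducible) analytic subvariety of `Ω`: a closed analytic subset of `Ω` whose
smooth locus is connected (and nonempty). -/
def IsSubvariety (Ω X : Set E) : Prop :=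
  IsAnalyticSubset Ω X ∧ IsConnected (smoothLocus X)

/-- `X` has dimension `d`: the largest dimension of `X` at a smooth point is `d`. -/
def HasDimension (X : Set E) (d : ℕ) : Prop :=
  IsGreatest {k | ∃ A T, IsSmoothPointWithTangent X A T ∧ Module.finrank ℂ T = k} d

theorem IsSmoothPointWithTangent.le [FiniteDimensional ℂ E] {X : Set E} {A : E}
    {T T' : Submodule ℂ E} (h : IsSmoothPointWithTangent X A T)
    (h' : IsSmoothPointWithTangent X A T') : T ≤ T' := by
  have : CompleteSpace E := FiniteDimensional.complete ℂ E
  obtain ⟨hAX, U, hU, hAU, m, F, hF, hXF, hs, rfl⟩ := h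
  obtain ⟨-, U', hU', hAU', m', G, hG, hXG, -, rfl⟩ := h'
  have hFs : HasStrictFDerivAt F (fderiv ℂ F A) A := (hF A hAU).hasStrictFDerivAt
  have hGs : HasStrictFDerivAt G (fderiv ℂ G A) A := (hG A hAU').hasStrictFDerivAt
  have hr : (fderiv ℂ F A).range = ⊤ := LinearMap.range_eq_top.2 hs
  have hFA : F A = 0 := by
    have : A ∈ X ∩ U := ⟨hAX, hAU⟩
    rw [hXF] at this
    exact this.2
  intro v hv
  set φ := hFs.implicitFunction F (fderiv ℂ F A) hr (F A) with hφdef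
  have hφ : HasStrictFDerivAt φ (fderiv ℂ F A).ker.subtypeL 0 := hFs.to_implicitFunction hr
  have hφ0 : φ 0 = A := by simp [hφdef]
  have hF0 : ∀ᶠ z in nhds 0, F (φ z) = F A :=
    ((Continuous.prodMk_right (F A)).tendsto 0).eventually (hFs.map_implicitFunction_eq hr)
  have hcont : Filter.Tendsto φ (nhds 0) (nhds A) := by
    simpa [hφ0] using hφ.hasFDerivAt.continuousAt.tendsto
  have hG0 : G ∘ φ =ᶠ[nhds 0] fun _ => 0 := by
    filter_upwards [hF0, hcont.eventually (hU.mem_nhds hAU),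
      hcont.eventually (hU'.mem_nhds hAU')] with z h1 h2 h3
    have hz : φ z ∈ X ∩ U := by
      rw [hXF]
      exact ⟨h2, h1.trans hFA⟩
    have hz' : φ z ∈ X ∩ U' := ⟨hz.1, h3⟩
    rw [hXG] at hz'
    exact hz'.2
  have hd : HasFDerivAt (G ∘ φ) ((fderiv ℂ G A).comp (fderiv ℂ F A).ker.subtypeL) 0 :=
    HasFDerivAt.comp 0 (by rw [hφ0]; exact hGs.hasFDerivAt) hφ.hasFDerivAt
  have h0 := (hd.congr_of_eventuallyEq hG0.symm).unique (hasFDerivAt_const 0 0)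
  simpa using DFunLike.congr_fun h0 (⟨v, hv⟩ : (fderiv ℂ F A).ker)

theorem IsSmoothPointWithTangent.unique [FiniteDimensional ℂ E] {X : Set E} {A : E}
    {T T' : Submodule ℂ E} (h : IsSmoothPointWithTangent X A T)
    (h' : IsSmoothPointWithTangent X A T') : T = T' :=
  le_antisymm (h.le h') (h'.le h)

end AnalyticSets

/-- `S_g`: the space of symmetric complex `g × g` matrices. -/
def symMatrices (g : ℕ) : Submodule ℂ (Matrix (Fin g) (Fin g) ℂ) where
  carrier := {M | M.IsSymm}
  add_mem' ha hb := ha.add hb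
  zero_mem' := Matrix.isSymm_zero
  smul_mem' c _ hM := hM.smul c

/-- The Siegel upper half space `ℋ_g`, as a subset of `S_g`: symmetric matrices with positive
definite imaginary part. -/
def siegelSpace (g : ℕ) : Set (symMatrices g) :=
  {M | ((M : Matrix (Fin g) (Fin g) ℂ).map Complex.im).PosDef}

/-- `W^⊥ ⊆ S_g`: the symmetric matrices whose kernel contains `W`. -/
def perp {g : ℕ} (W : Submodule ℂ (Fin g → ℂ)) : Submodule ℂ (symMatrices g) where
  carrier := {M | ∀ w ∈ W, (M : Matrix (Fin g) (Fin g) ℂ).mulVec w = 0}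
  add_mem' ha hb w hw := by simp [Matrix.add_mulVec, ha w hw, hb w hw]
  zero_mem' w _ := by simp
  smul_mem' c M hM w hw := by simp [Matrix.smul_mulVec, hM w hw]

/-- The slice `{M ∈ ℋ_g : M|_W = τ|_W}`. -/
def slice {g : ℕ} (W : Submodule ℂ (Fin g → ℂ)) (τ : symMatrices g) : Set (symMatrices g) :=
  {M ∈ siegelSpace g | ∀ w ∈ W,
    (M : Matrix (Fin g) (Fin g) ℂ).mulVec w = (τ : Matrix (Fin g) (Fin g) ℂ).mulVec w}

end SiegelSlice

open SiegelSlice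

/-! Near a smooth point `a`, put `W = W(a)` and let `Q` be a projection of `ℂ ^ g` with kernel `W`.
Then `M ↦ Qᵀ M Q` projects onto the tangent space `perp W`, so `X` is parametrized near `a` by some
`Ψ` on an open piece of `perp W` with `Qᵀ Ψ(s) Q = s`. Each `W(Ψ s)` is a graph over `W`: every `w ∈
W` has a unique `l(s) ∈ range Q` with `w + l(s) ∈ W(Ψ s)`. Since `dΨ` kills `w + l(s)`, the function
`Qᵀ Ψ(s) w` has derivative `B ↦ -B l(s)`, and symmetry of second derivatives gives `B dl(C) = C
dl(B)` for all `B`, `C` in `perp W`. As `W` has codimension `i - 1 ≥ 2`, this forces `dl(C) ∈ W ∩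
range Q = 0` (`mem_of_forall_mulVec_comm`). So `l` is constant, equal to its initial value `0`; both
`W(Ψ s)` and `Ψ(s) w` are constant, and `X` is locally an open piece of `a + perp W`.

Connectedness of the smooth locus makes `W` and the class of `A` modulo `perp W` globally constant.
Density of smooth points then puts `X` inside a slice; convexity of `ℋ_g` and the identity theorem
along segments give the reverse inclusion. -/

namespace SiegelSlice

open Filter Topology

/-! ### Analytic sets: parametrization, density of smooth points, identity theorem. -/

section AnalyticSets

variable {E : Type*} [NormedAddCommGroup E] [NormedSpace ℂ E]

theorem isSmoothPointWithTangent_iff {X : Set E} {A : E} {T : Submodule ℂ E} :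
    IsSmoothPointWithTangent X A T ↔ A ∈ X ∧ ∃ (m : ℕ) (F : E → Fin m → ℂ), AnalyticAt ℂ F A ∧
      (∀ᶠ x in 𝓝 A, x ∈ X ↔ F x = 0) ∧ Function.Surjective (fderiv ℂ F A) ∧
      T = LinearMap.ker (fderiv ℂ F A : E →ₗ[ℂ] (Fin m → ℂ)) := by
  refine and_congr_right fun _ => ⟨?_, ?_⟩
  · rintro ⟨U, hU, hAU, m, F, hF, hXF, hs, hT⟩
    refine ⟨m, F, hF A hAU, ?_, hs, hT⟩
    filter_upwards [hU.mem_nhds hAU] with x hx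
    simpa [hx] using Set.ext_iff.1 hXF x
  · rintro ⟨m, F, hF, hXF, hs, hT⟩
    obtain ⟨U, hUF, hU, hAU⟩ := eventually_nhds_iff.1 (hF.eventually_analyticAt.and hXF)
    refine ⟨U, hU, hAU, m, F, fun x hx => (hUF x hx).1, ?_, hs, hT⟩
    ext x
    constructor
    · exact fun hx => ⟨hx.2, (hUF x hx.2).2.1 hx.1⟩
    · exact fun hx => ⟨(hUF x hx.1).2.2 hx.2, hx.1⟩

/-- The zero locus of a holomorphic submersion is locally parametrized by the tangent space `K`,
compatibly with any given linear projection onto `K`. -/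
theorem exists_analytic_section [FiniteDimensional ℂ E] {m : ℕ} {F : E → Fin m → ℂ} {q : E}
    (hF : AnalyticAt ℂ F q) (hFq : F q = 0) (hs : Function.Surjective (fderiv ℂ F q))
    {K : Submodule ℂ E} (hK : K = LinearMap.ker (fderiv ℂ F q : E →ₗ[ℂ] (Fin m → ℂ)))
    (p : E →L[ℂ] K) (hp : ∀ k : K, p k = k) :
    ∃ Ψ : K → E, AnalyticAt ℂ Ψ (p q) ∧ Ψ (p q) = q ∧
      (∀ᶠ k in 𝓝 (p q), F (Ψ k) = 0 ∧ p (Ψ k) = k) ∧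
      (∀ᶠ x in 𝓝 q, F x = 0 → Ψ (p x) = x) ∧
      ∀ᶠ x in 𝓝 q, Function.Surjective ((fderiv ℂ F x).prod p) := by
  have : CompleteSpace E := FiniteDimensional.complete ℂ E
  -- `(F, p)` has invertible derivative at `q` because `p` is the identity on `ker dF`; the section
  -- is its local inverse restricted to `{0} × K`.
  have hinj : Function.Injective ((fderiv ℂ F q).prod p) := by
    rw [injective_iff_map_eq_zero]
    intro x hx
    have h1 : fderiv ℂ F q x = 0 := congrArg Prod.fst hx
    have h2 : p x = 0 := congrArg Prod.snd hx
    have hxK : x ∈ K := by rw [hK]; exact h1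
    have := hp ⟨x, hxK⟩
    simp only [h2] at this
    exact (congrArg Subtype.val this).symm
  have hsurj : Function.Surjective ((fderiv ℂ F q).prod p) := by
    rintro ⟨y, k⟩
    obtain ⟨x, rfl⟩ := hs y
    have hk : fderiv ℂ F q ((k - p x : K) : E) = 0 := by
      have : ((k - p x : K) : E) ∈ LinearMap.ker (fderiv ℂ F q : E →ₗ[ℂ] (Fin m → ℂ)) :=
        hK ▸ (k - p x).2
      exact this
    refine ⟨x + ((k - p x : K) : E), Prod.ext ?_ ?_⟩
    · change fderiv ℂ F q (x + ((k - p x : K) : E)) = fderiv ℂ F q x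
      rw [map_add, hk, add_zero]
    · change p (x + ((k - p x : K) : E)) = k
      rw [map_add, hp, add_sub_cancel]
  let e : E ≃L[ℂ] (Fin m → ℂ) × K :=
    (LinearEquiv.ofBijective ((fderiv ℂ F q).prod p : E →ₗ[ℂ] (Fin m → ℂ) × K)
      ⟨hinj, hsurj⟩).toContinuousLinearEquiv
  have he : (e : E →L[ℂ] (Fin m → ℂ) × K) = (fderiv ℂ F q).prod p := by
    ext x <;> rfl
  let Φ : E → (Fin m → ℂ) × K := fun x => (F x, p x)
  have hΦ : AnalyticAt ℂ Φ q := hF.prod (p.analyticAt q)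
  have hΦ' : HasStrictFDerivAt Φ (e : E →L[ℂ] (Fin m → ℂ) × K) q := by
    rw [he]
    exact hF.hasStrictFDerivAt.prodMk p.hasStrictFDerivAt
  have hΦq : Φ q = (0, p q) := by simp [Φ, hFq]
  let R := hΦ'.toOpenPartialHomeomorph Φ
  have hR : AnalyticAt ℂ (hΦ'.localInverse Φ e q) (Φ q) := by
    refine ContDiffAt.analyticAt ?_
    refine R.contDiffAt_symm (f₀' := e) hΦ'.image_mem_toOpenPartialHomeomorph_target ?_ ?_
    · have : R.symm (Φ q) = q := hΦ'.localInverse_apply_image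
      rw [this]; exact hΦ'.hasFDerivAt
    · have : R.symm (Φ q) = q := hΦ'.localInverse_apply_image
      rw [this]; exact hΦ.contDiffAt
  have hj : AnalyticAt ℂ (fun k : K => ((0 : Fin m → ℂ), k)) (p q) :=
    analyticAt_const.prod analyticAt_id
  refine ⟨fun k => hΦ'.localInverse Φ e q (0, k), ?_, ?_, ?_, ?_, ?_⟩
  · exact AnalyticAt.fun_comp (by rw [← hΦq]; exact hR) hj
  · change hΦ'.localInverse Φ e q (0, p q) = q
    rw [← hΦq]; exact hΦ'.localInverse_apply_image
  · have h := hΦ'.eventually_right_inverse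
    rw [hΦq] at h
    filter_upwards [hj.continuousAt.eventually h] with k hk
    exact ⟨congrArg Prod.fst hk, congrArg Prod.snd hk⟩
  · filter_upwards [hΦ'.eventually_left_inverse] with x hx h0
    rw [← h0]; exact hx
  -- Isomorphisms form an open set of linear maps, so the derivative of `(F, p)` stays surjective
  -- nearby.
  · have hn := hΦ.fderiv.continuousAt.eventually
      (by rw [hΦ'.hasFDerivAt.fderiv]; exact ContinuousLinearEquiv.nhds e)
    filter_upwards [hn, hF.eventually_analyticAt] with x hx hFx
    have hd : fderiv ℂ Φ x = (fderiv ℂ F x).prod p :=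
      (hFx.differentiableAt.hasFDerivAt.prodMk p.hasFDerivAt).fderiv
    rw [← hd]
    obtain ⟨e', he'⟩ := hx
    rw [← he']
    exact e'.surjective

/-- If the derivative of every holomorphic function vanishing on `S` vanishes on `S` too, then
every holomorphic function vanishing on `S` is zero around the points of `S`. -/
theorem eq_zero_of_forall_fderiv_eq_zero [CompleteSpace E] {S : Set E} {a : E} {ε : ℝ}
    (haS : a ∈ S)
    (hS : ∀ h : E → ℂ, AnalyticOnNhd ℂ h (Metric.ball a ε) →
      (∀ x ∈ S ∩ Metric.ball a ε, h x = 0) → ∀ x ∈ S ∩ Metric.ball a ε, fderiv ℂ h x = 0)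
    {h : E → ℂ} (hh : AnalyticOnNhd ℂ h (Metric.ball a ε))
    (h0 : ∀ x ∈ S ∩ Metric.ball a ε, h x = 0) {x : E} (hx : x ∈ Metric.ball a ε) : h x = 0 := by
  have ha : a ∈ Metric.ball a ε := Metric.mem_ball_self (Metric.pos_of_mem_ball hx)
  let v := x - a
  -- The hypothesis applies again to each directional derivative, so all iterates vanish on `S`. At
  -- `a` they are the derivatives of `h` along the line towards `x`, hence `h` vanishes on that line
  -- within the ball.
  let D : (E → ℂ) → E → ℂ := fun u y => fderiv ℂ u y v
  have hD : ∀ n, AnalyticOnNhd ℂ (D^[n] h) (Metric.ball a ε) ∧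
      ∀ y ∈ S ∩ Metric.ball a ε, D^[n] h y = 0 := by
    intro n
    induction n with
    | zero => exact ⟨hh, h0⟩
    | succ n ih =>
      rw [Function.iterate_succ_apply']
      refine ⟨fun y hy => ?_, fun y hy => ?_⟩
      · exact ((ContinuousLinearMap.apply ℂ ℂ v).analyticAt _).comp (ih.1 y hy).fderiv
      · simp [D, hS _ ih.1 ih.2 y hy]
  let ℓ : ℂ → E := fun t => a + t • v
  have hℓ : ∀ t, HasDerivAt ℓ v t := fun t => by
    simpa [ℓ] using ((hasDerivAt_id t).smul_const v).const_add a
  have hℓa : ∀ t, AnalyticAt ℂ ℓ t := fun t =>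
    analyticAt_const.add (analyticAt_id.smul analyticAt_const)
  let O : Set ℂ := ℓ ⁻¹' Metric.ball a ε
  have hO : IsOpen O := Metric.isOpen_ball.preimage
    (continuous_iff_continuousAt.2 fun t => (hℓ t).continuousAt)
  have h0O : (0 : ℂ) ∈ O := by simpa [O, ℓ] using ha
  have h1O : (1 : ℂ) ∈ O := by simpa [O, ℓ, v] using hx
  have hOc : Convex ℝ O := by
    intro s hs t ht b c hb hc hbc
    have : ℓ (b • s + c • t) = b • ℓ s + c • ℓ t := by
      simp only [ℓ, smul_add, add_smul]
      have : a = b • a + c • a := by rw [← add_smul, hbc, one_smul]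
      nth_rewrite 1 [this]
      simp only [smul_assoc]
      abel
    change ℓ (b • s + c • t) ∈ Metric.ball a ε
    rw [this]
    exact convex_ball a ε hs ht hb hc hbc
  have hφ : AnalyticOnNhd ℂ (h ∘ ℓ) O := fun t ht => (hh _ ht).comp (hℓa t)
  have hiter : ∀ n, ∀ t ∈ O, iteratedDeriv n (h ∘ ℓ) t = D^[n] h (ℓ t) := by
    intro n
    induction n with
    | zero => intro t _; simp
    | succ n ih =>
      intro t ht
      have he : iteratedDeriv n (h ∘ ℓ) =ᶠ[𝓝 t] (D^[n] h) ∘ ℓ := by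
        filter_upwards [hO.mem_nhds ht] with s hs using ih s hs
      rw [iteratedDeriv_succ, he.deriv_eq, Function.iterate_succ_apply']
      exact (((hD n).1 _ ht).differentiableAt.hasFDerivAt.comp_hasDerivAt t (hℓ t)).deriv
  have htop : analyticOrderAt (h ∘ ℓ) 0 = ⊤ := by
    refine ENat.eq_top_iff_forall_ge.2 fun n => ?_
    rw [natCast_le_analyticOrderAt_iff_iteratedDeriv_eq_zero (hφ 0 h0O)]
    intro k _
    rw [hiter k 0 h0O]
    have : ℓ 0 = a := by simp [ℓ]
    rw [this]
    exact (hD k).2 a ⟨haS, ha⟩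
  have := hφ.eqOn_zero_of_preconnected_of_eventuallyEq_zero hOc.isPreconnected h0O
    (analyticOrderAt_eq_top.1 htop) h1O
  simpa [ℓ, v] using this

/-- The smooth points of an analytic set are dense in it. -/
theorem IsAnalyticSubset.subset_closure_smoothLocus [FiniteDimensional ℂ E] {Ω X : Set E}
    (hX : IsAnalyticSubset Ω X) : X ⊆ closure (smoothLocus X) := by
  have : CompleteSpace E := FiniteDimensional.complete ℂ E
  intro a haX
  refine mem_closure_iff.2 fun O hO haO => ?_
  -- The possible numbers of independent holomorphic equations satisfied by `X` near points of `X ∩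
  -- O`. Where the number is maximal, these equations turn out to define `X`.
  let P : Set ℕ := {r | ∃ q ∈ X ∩ O, ∃ F : E → Fin r → ℂ, AnalyticAt ℂ F q ∧
    (∀ᶠ x in 𝓝 q, x ∈ X → F x = 0) ∧ Function.Surjective (fderiv ℂ F q)}
  have hPne : P.Nonempty := ⟨0, a, ⟨haX, haO⟩, 0, analyticAt_const,
    .of_forall fun _ _ => rfl, fun y => ⟨0, Subsingleton.elim _ _⟩⟩
  have hPb : BddAbove P := by
    refine ⟨Module.finrank ℂ E, ?_⟩
    rintro r ⟨q, -, F, -, -, hs⟩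
    simpa using LinearMap.finrank_le_finrank_of_surjective
      (f := (fderiv ℂ F q : E →ₗ[ℂ] (Fin r → ℂ))) hs
  obtain ⟨r, hr, hmax⟩ : ∃ r, r ∈ P ∧ r + 1 ∉ P :=
    ⟨sSup P, Nat.sSup_mem hPne hPb, fun h => by have := le_csSup hPb h; omega⟩
  obtain ⟨q, ⟨hqX, hqO⟩, F, hF, hXF, hs⟩ := hr
  have hFq : F q = 0 := hXF.self_of_nhds hqX
  let K : Submodule ℂ E := LinearMap.ker (fderiv ℂ F q : E →ₗ[ℂ] (Fin r → ℂ))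
  obtain ⟨p₀, hp₀⟩ := K.subtype.exists_leftInverse_of_injective K.ker_subtype
  let p : E →L[ℂ] K := LinearMap.toContinuousLinearMap p₀
  have hp : ∀ k : K, p k = k := fun k => LinearMap.congr_fun hp₀ k
  obtain ⟨Ψ, hΨ, hΨq, hFΨ, hΨp, hsurj⟩ := exists_analytic_section hF hFq hs rfl p hp
  obtain ⟨U, hU, hqU, -, k, f, hf, hXf⟩ := hX.2 q (hX.1 hqX)
  have hgood : ∀ᶠ x in 𝓝 q, x ∈ O ∧ x ∈ U ∧ AnalyticAt ℂ F x ∧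
      (∀ᶠ y in 𝓝 x, y ∈ X → F y = 0) ∧ (∀ᶠ y in 𝓝 x, F y = 0 → Ψ (p y) = y) ∧
      Function.Surjective ((fderiv ℂ F x).prod p) := by
    filter_upwards [hO.mem_nhds hqO, hU.mem_nhds hqU, hF.eventually_analyticAt,
      eventually_eventually_nhds.2 hXF, eventually_eventually_nhds.2 hΨp, hsurj]
      with x h1 h2 h3 h4 h5 h6 using ⟨h1, h2, h3, h4, h5, h6⟩
  have hball := hΨ.eventually_analyticAt.and
    (hFΨ.and (hΨ.continuousAt.eventually (by rw [hΨq]; exact hgood)))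
  obtain ⟨ε, hε, hball⟩ := Metric.eventually_nhds_iff_ball.1 hball
  -- Otherwise `h ∘ p` would be one more equation of `X` independent of `F`, against the maximality
  -- of `r`.
  have hvanish : ∀ h : K → ℂ, AnalyticOnNhd ℂ h (Metric.ball (p q) ε) →
      (∀ x ∈ Ψ ⁻¹' X ∩ Metric.ball (p q) ε, h x = 0) →
      ∀ x ∈ Ψ ⁻¹' X ∩ Metric.ball (p q) ε, fderiv ℂ h x = 0 := by
    rintro h hh h0 z ⟨hzX, hz⟩
    by_contra hne
    obtain ⟨-, ⟨-, hpz⟩, hzO, -, hFz, hXFz, hΨz, hsz⟩ := hball z hz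
    have hpc : Tendsto p (𝓝 (Ψ z)) (𝓝 z) := by
      simpa [hpz] using p.continuous.tendsto (Ψ z)
    let e : (ℂ × (Fin r → ℂ)) ≃L[ℂ] (Fin (r + 1) → ℂ) :=
      ContinuousLinearEquiv.ofFinrankEq (by simp [add_comm])
    have hhp : AnalyticAt ℂ (h ∘ p) (Ψ z) :=
      AnalyticAt.comp (by rw [hpz]; exact hh z hz) (p.analyticAt _)
    have hd : HasFDerivAt (fun x => e (h (p x), F x))
        ((e : _ →L[ℂ] _).comp (((fderiv ℂ h z).comp p).prod (fderiv ℂ F (Ψ z)))) (Ψ z) := by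
      refine e.hasFDerivAt.comp _ (HasFDerivAt.prodMk ?_ hFz.differentiableAt.hasFDerivAt)
      refine HasFDerivAt.comp _ ?_ p.hasFDerivAt
      rw [hpz]
      exact (hh z hz).differentiableAt.hasFDerivAt
    refine hmax ⟨Ψ z, ⟨hzX, hzO⟩, fun x => e (h (p x), F x), ?_, ?_, ?_⟩
    · exact (e.toContinuousLinearMap.analyticAt _).comp (hhp.prod hFz)
    · filter_upwards [hXFz, hΨz, hpc.eventually (Metric.isOpen_ball.mem_nhds hz)]
        with x h1 h2 h3 hxX
      have hx : h (p x) = 0 := by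
        refine h0 _ ⟨?_, h3⟩
        change Ψ (p x) ∈ X
        rwa [h2 (h1 hxX)]
      rw [hx, h1 hxX]
      exact map_zero e
    · rw [hd.fderiv]
      refine e.surjective.comp ?_
      rintro ⟨c, y⟩
      obtain ⟨w, hw⟩ : ∃ w, fderiv ℂ h z w ≠ 0 := by
        by_contra! hall
        exact hne (ContinuousLinearMap.ext hall)
      obtain ⟨x, hx⟩ := hsz (y, (c / fderiv ℂ h z w) • w)
      have hx1 : fderiv ℂ F (Ψ z) x = y := congrArg Prod.fst hx
      have hx2 : p x = (c / fderiv ℂ h z w) • w := congrArg Prod.snd hx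
      refine ⟨x, Prod.ext ?_ hx1⟩
      change fderiv ℂ h z (p x) = c
      rw [hx2, map_smul, smul_eq_mul, div_mul_cancel₀ _ hw]
  have hfΨ : ∀ j, ∀ z ∈ Metric.ball (p q) ε, f j (Ψ z) = 0 := by
    intro j z hz
    refine eq_zero_of_forall_fderiv_eq_zero (S := Ψ ⁻¹' X) (h := f j ∘ Ψ) (by simpa [hΨq])
      hvanish (fun y hy => ?_) ?_ hz
    · exact (hf j _ (hball y hy).2.2.2.1).comp (hball y hy).1
    · rintro y ⟨hyX, hy⟩
      have : Ψ y ∈ X ∩ U := ⟨hyX, (hball y hy).2.2.2.1⟩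
      rw [hXf] at this
      exact this.2 j
  refine ⟨q, hqO, K, isSmoothPointWithTangent_iff.2 ⟨hqX, r, F, hF, ?_, hs, rfl⟩⟩
  filter_upwards [hXF, hΨp, hU.mem_nhds hqU,
    (p.continuous.tendsto q).eventually (Metric.ball_mem_nhds _ hε)] with x h1 h2 h3 h4
  refine ⟨h1, fun h => ?_⟩
  have : x ∈ X ∩ U := by
    rw [hXf]
    refine ⟨h3, fun j => ?_⟩
    rw [← h2 h]
    exact hfΨ j _ h4
  exact this.1

/-- Identity theorem along a line: an analytic set containing a neighbourhood of the initial point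
of a segment in `Ω` on the complex line through it contains the whole segment. -/
theorem IsAnalyticSubset.mem_of_eventually_mem {Ω X : Set E} (hX : IsAnalyticSubset Ω X) {a v : E}
    (hΩ : ∀ t ∈ segment ℝ (0 : ℂ) 1, a + t • v ∈ Ω) (ha : ∀ᶠ t : ℂ in 𝓝 0, a + t • v ∈ X) :
    a + v ∈ X := by
  let γ : ℂ → E := fun t => a + t • v
  have hγ : ∀ t, AnalyticAt ℂ γ t := fun t =>
    analyticAt_const.add (analyticAt_id.smul analyticAt_const)
  have hsub : segment ℝ (0 : ℂ) 1 ⊆ {t | ∀ᶠ s in 𝓝 t, γ s ∈ X} := by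
    refine (convex_segment (0 : ℂ) 1).isPreconnected.subset_of_closure_inter_subset
      isOpen_setOfPred_eventually_nhds ⟨0, left_mem_segment ℝ 0 1, ha⟩ ?_
    rintro t ⟨htc, hts⟩
    by_contra htX
    obtain ⟨U, hU, htU, -, k, f, hf, hXf⟩ := hX.2 (γ t) (hΩ t hts)
    have hev : ∀ᶠ s in 𝓝 t, γ s ∈ U := (hγ t).continuousAt.eventually (hU.mem_nhds htU)
    have hmem : ∀ s, γ s ∈ U → (γ s ∈ X ↔ ∀ j, f j (γ s) = 0) := fun s hs => by
      simpa [hs] using Set.ext_iff.1 hXf (γ s)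
    -- Points `s` near which the line lies in `X` accumulate at `t`, and differ from `t` by `htX`;
    -- so the zeros of each `f j ∘ γ` are not isolated at `t`.
    have hfreq : ∃ᶠ s in 𝓝[≠] t, γ s ∈ X := by
      rw [frequently_nhdsWithin_iff]
      refine (mem_closure_iff_frequently.1 htc).mono fun s hs => ⟨hs.self_of_nhds, ?_⟩
      rintro rfl
      exact htX hs
    have hzero : ∀ j, ∀ᶠ s in 𝓝 t, f j (γ s) = 0 := fun j => by
      have hfa : AnalyticAt ℂ (f j ∘ γ) t := (hf j _ htU).comp (hγ t)
      refine hfa.frequently_zero_iff_eventually_zero.1 ?_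
      exact (hfreq.and_eventually (hev.filter_mono nhdsWithin_le_nhds)).mono
        fun s hs => (hmem s hs.2).1 hs.1 j
    refine htX ?_
    filter_upwards [hev, eventually_all.2 hzero] with s h1 h2 using (hmem s h1).2 h2
  have := (hsub (right_mem_segment ℝ 0 1)).self_of_nhds
  simpa [γ] using this

end AnalyticSets

/-! ### Linear algebra of `perp W`. -/

section LinearAlgebra

open Matrix

variable {g : ℕ} {W : Submodule ℂ (Fin g → ℂ)}

theorem exists_dotProduct_ne_zero {v : Fin g → ℂ} (hv : v ∉ W) :
    ∃ l : Fin g → ℂ, (∀ w ∈ W, l ⬝ᵥ w = 0) ∧ l ⬝ᵥ v ≠ 0 := by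
  obtain ⟨f, hfv, hf⟩ := Submodule.exists_le_ker_of_notMem hv
  have hl : ∀ x, (dotProductEquiv ℂ (Fin g)).symm f ⬝ᵥ x = f x := fun x => by
    conv_rhs => rw [← (dotProductEquiv ℂ (Fin g)).apply_symm_apply f]
    rfl
  exact ⟨(dotProductEquiv ℂ (Fin g)).symm f, fun w hw => by rw [hl]; exact hf hw, by rwa [hl]⟩

/-- The symmetric matrix of the square of the linear form `l`. -/
def sqForm (l : Fin g → ℂ) : symMatrices g :=
  ⟨vecMulVec l l, by
    change (vecMulVec l l)ᵀ = _
    rw [transpose_vecMulVec]⟩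

theorem sqForm_mulVec (l v : Fin g → ℂ) :
    (sqForm l : Matrix (Fin g) (Fin g) ℂ) *ᵥ v = (l ⬝ᵥ v) • l := by
  change vecMulVec l l *ᵥ v = _
  rw [vecMulVec_mulVec]
  ext
  simp [mul_comm]

theorem sqForm_mem_perp {l : Fin g → ℂ} (hl : ∀ w ∈ W, l ⬝ᵥ w = 0) : sqForm l ∈ perp W :=
  fun w hw => by rw [sqForm_mulVec, hl w hw, zero_smul]

/-- `W` is the common kernel of the matrices in `perp W`. -/
theorem mem_of_forall_mem_perp {v : Fin g → ℂ}
    (hv : ∀ B ∈ perp W, (B : Matrix (Fin g) (Fin g) ℂ) *ᵥ v = 0) : v ∈ W := by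
  by_contra hvW
  obtain ⟨l, hl, hlv⟩ := exists_dotProduct_ne_zero hvW
  have := hv _ (sqForm_mem_perp hl)
  rw [sqForm_mulVec, smul_eq_zero, or_iff_right hlv] at this
  simp [this] at hlv

/-- If `W` has codimension at least two, its annihilator is not spanned by one form. -/
theorem exists_annihilator_notMem_span (hW : Module.finrank ℂ W + 2 ≤ g) (m : Fin g → ℂ) :
    ∃ k : Fin g → ℂ, (∀ w ∈ W, k ⬝ᵥ w = 0) ∧ k ∉ Submodule.span ℂ {m} := by
  obtain ⟨u, hum, huW⟩ : ∃ u, m ⬝ᵥ u = 0 ∧ u ∉ W := by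
    by_contra! h
    have hle : LinearMap.ker (dotProductEquiv ℂ (Fin g) m) ≤ W := fun u hu => h u hu
    have h1 := Submodule.finrank_mono hle
    have h2 := (dotProductEquiv ℂ (Fin g) m).finrank_range_add_finrank_ker
    have h3 := Submodule.finrank_le (LinearMap.range (dotProductEquiv ℂ (Fin g) m))
    simp at h2 h3
    omega
  obtain ⟨k, hk, hku⟩ := exists_dotProduct_ne_zero huW
  refine ⟨k, hk, fun hks => ?_⟩
  obtain ⟨c, rfl⟩ := Submodule.mem_span_singleton.1 hks
  exact hku (by simp [hum])

/-- On squares of forms `l`, `m` annihilating `W` the identity reads `(m ⬝ D(l²)) m = (l ⬝ D(m²))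
l`, so only multiples of `m` can be nonzero on `D(m²)`. In codimension one this is no restriction;
in codimension at least two it forces `D(m²) ∈ W`. -/
theorem mem_of_forall_mulVec_comm (hW : Module.finrank ℂ W + 2 ≤ g)
    (D : perp W → Fin g → ℂ)
    (hD : ∀ B C : perp W, ((B : symMatrices g) : Matrix (Fin g) (Fin g) ℂ) *ᵥ D C =
      ((C : symMatrices g) : Matrix (Fin g) (Fin g) ℂ) *ᵥ D B) (C : perp W) : D C ∈ W := by
  have hsq : ∀ m (hm : ∀ w ∈ W, m ⬝ᵥ w = 0), D ⟨sqForm m, sqForm_mem_perp hm⟩ ∈ W := by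
    intro m hm
    by_contra hv
    have hspan : ∀ l : Fin g → ℂ, (∀ w ∈ W, l ⬝ᵥ w = 0) →
        l ⬝ᵥ D ⟨sqForm m, sqForm_mem_perp hm⟩ ≠ 0 → l ∈ Submodule.span ℂ {m} := by
      intro l hl hlv
      have := hD ⟨sqForm l, sqForm_mem_perp hl⟩ ⟨sqForm m, sqForm_mem_perp hm⟩
      rw [sqForm_mulVec, sqForm_mulVec] at this
      rw [← Submodule.smul_mem_iff _ hlv, this]
      exact Submodule.smul_mem _ _ (Submodule.mem_span_singleton_self m)
    -- With `k` outside the line of `m`, both `l` and `l + k` are nonzero on `D(m²)`, hence lie on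
    -- that line, and so would `k`.
    obtain ⟨k, hk, hkm⟩ := exists_annihilator_notMem_span hW m
    obtain ⟨l, hl, hlv⟩ := exists_dotProduct_ne_zero hv
    have hkv : k ⬝ᵥ D ⟨sqForm m, sqForm_mem_perp hm⟩ = 0 := by
      by_contra h
      exact hkm (hspan k hk h)
    have hlk := hspan (l + k) (fun w hw => by simp [hl w hw, hk w hw])
      (by rwa [add_dotProduct, hkv, add_zero])
    exact hkm ((Submodule.add_mem_iff_right _ (hspan l hl hlv)).1 hlk)
  -- For general `C`, pairing with `m²` gives `(m ⬝ D C) m = C D(m²) = 0`.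
  by_contra hC
  obtain ⟨m, hm, hmC⟩ := exists_dotProduct_ne_zero hC
  have h1 := hD ⟨sqForm m, sqForm_mem_perp hm⟩ C
  rw [sqForm_mulVec, C.2 _ (hsq m hm), smul_eq_zero, or_iff_right hmC] at h1
  simp [h1] at hmC

theorem exists_projection_matrix (W : Submodule ℂ (Fin g → ℂ)) :
    ∃ Q : Matrix (Fin g) (Fin g) ℂ, (∀ w ∈ W, Q *ᵥ w = 0) ∧ ∀ v, v - Q *ᵥ v ∈ W := by
  obtain ⟨r, hr⟩ := W.subtype.exists_leftInverse_of_injective W.ker_subtype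
  refine ⟨LinearMap.toMatrix' (LinearMap.id - W.subtype ∘ₗ r), fun w hw => ?_, fun v => ?_⟩
  · have : r w = ⟨w, hw⟩ := LinearMap.congr_fun hr ⟨w, hw⟩
    rw [LinearMap.toMatrix'_mulVec]
    simp [this]
  · rw [LinearMap.toMatrix'_mulVec]
    simp

/-- A projection `Q` of `ℂ ^ g` with kernel `W` induces a projection of `S_g` onto `perp W`. -/
theorem exists_projection_perp {Q : Matrix (Fin g) (Fin g) ℂ} (hQ : ∀ w ∈ W, Q *ᵥ w = 0)
    (hQ' : ∀ v, v - Q *ᵥ v ∈ W) :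
    ∃ p : symMatrices g →ₗ[ℂ] symMatrices g,
      (∀ M, (p M : Matrix (Fin g) (Fin g) ℂ) = Qᵀ * M * Q) ∧
      (∀ M, p M ∈ perp W) ∧ ∀ k ∈ perp W, p k = k := by
  have hsymm : ∀ M : symMatrices g, Qᵀ * (M : Matrix (Fin g) (Fin g) ℂ) * Q ∈ symMatrices g := by
    intro M
    have hM : (M : Matrix (Fin g) (Fin g) ℂ)ᵀ = M := M.2
    change (Qᵀ * (M : Matrix (Fin g) (Fin g) ℂ) * Q)ᵀ = _
    simp [transpose_mul, hM, Matrix.mul_assoc]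
  let p : symMatrices g →ₗ[ℂ] symMatrices g :=
    { toFun := fun M => ⟨Qᵀ * M * Q, hsymm M⟩
      map_add' := fun M N => by
        ext : 1
        simp [Matrix.mul_add, Matrix.add_mul]
      map_smul' := fun c M => by
        ext : 1
        simp }
  refine ⟨p, fun M => rfl, fun M w hw => ?_, fun k hkW => ?_⟩
  · change (Qᵀ * (M : Matrix (Fin g) (Fin g) ℂ) * Q) *ᵥ w = 0
    rw [← mulVec_mulVec, hQ w hw, mulVec_zero]
  -- `k` kills `v - Q v ∈ W`, so `k Q = k`; transposing gives `Qᵀ k = k`.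
  have hkQ : (k : Matrix (Fin g) (Fin g) ℂ) * Q = k := by
    refine Matrix.ext_of_mulVec_single fun i => ?_
    have := hkW _ (hQ' (Pi.single i 1))
    rw [mulVec_sub, sub_eq_zero] at this
    rw [← mulVec_mulVec, this]
  have hk : (k : Matrix (Fin g) (Fin g) ℂ)ᵀ = k := k.2
  have hQk : Qᵀ * (k : Matrix (Fin g) (Fin g) ℂ) = k := by
    have := congrArg transpose hkQ
    rwa [transpose_mul, hk] at this
  ext : 1
  change Qᵀ * (k : Matrix (Fin g) (Fin g) ℂ) * Q = k
  rw [hQk, hkQ]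

end LinearAlgebra

/-- Symmetry of second derivatives for a function whose derivative is given by a pairing. -/
theorem pairing_fderiv_comm {K V Y : Type*} [NormedAddCommGroup K] [NormedSpace ℂ K]
    [CompleteSpace K] [NormedAddCommGroup V] [NormedSpace ℂ V] [NormedAddCommGroup Y]
    [NormedSpace ℂ Y] [CompleteSpace Y] (J : V →L[ℂ] K →L[ℂ] Y) {β : K → Y} {l : K → V} {t : K}
    (hβ : AnalyticAt ℂ β t) (hl : AnalyticAt ℂ l t)
    (h : ∀ᶠ u in 𝓝 t, fderiv ℂ β u = -J (l u)) (B C : K) :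
    J (fderiv ℂ l t C) B = J (fderiv ℂ l t B) C := by
  have hd : HasFDerivAt (fderiv ℂ β) (-(J.comp (fderiv ℂ l t))) t :=
    (J.hasFDerivAt.comp t hl.differentiableAt.hasFDerivAt).neg.congr_of_eventuallyEq h
  have := hβ.contDiffAt.isSymmSndFDerivAt_of_omega C B
  rw [hd.fderiv] at this
  exact neg_injective this

/-! ### Local constancy of `W` along a parametrized piece of `X`. -/

section LocalConstancy

open Matrix

variable {g : ℕ} {W : Submodule ℂ (Fin g → ℂ)}
  {E : Type*} [NormedAddCommGroup E] [NormedSpace ℂ E] [FiniteDimensional ℂ E]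
  {μ : E ≃ₗ[ℂ] symMatrices g}

/-- The subspace `perp W`, seen in a normed space `E` identified with `S_g`. -/
abbrev perpIn (μ : E ≃ₗ[ℂ] symMatrices g) (W : Submodule ℂ (Fin g → ℂ)) : Submodule ℂ E :=
  (perp W).comap μ.toLinearMap

/-- Evaluation of symmetric matrices at a vector, as a continuous linear map. -/
noncomputable def evalCLM (μ : E ≃ₗ[ℂ] symMatrices g) (w : Fin g → ℂ) : E →L[ℂ] (Fin g → ℂ) :=
  LinearMap.toContinuousLinearMap
    { toFun := fun M => (μ M : Matrix (Fin g) (Fin g) ℂ) *ᵥ w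
      map_add' := fun M N => by simp [add_mulVec]
      map_smul' := fun c M => by simp [smul_mulVec] }

theorem evalCLM_apply (w : Fin g → ℂ) (M : E) :
    evalCLM μ w M = (μ M : Matrix (Fin g) (Fin g) ℂ) *ᵥ w := rfl

/-- The pairing of `perp W` with a subspace `V`, curried on the side of `V`. -/
noncomputable def pairingCLM (μ : E ≃ₗ[ℂ] symMatrices g) (W V : Submodule ℂ (Fin g → ℂ)) :
    V →L[ℂ] (perpIn μ W →L[ℂ] (Fin g → ℂ)) :=
  LinearMap.toContinuousLinearMap
    { toFun := fun v => (evalCLM μ (v : Fin g → ℂ)).comp (perpIn μ W).subtypeL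
      map_add' := fun v v' => by
        ext B : 1
        simp [evalCLM_apply, mulVec_add]
      map_smul' := fun c v => by
        ext B : 1
        simp [evalCLM_apply, mulVec_smul] }

theorem pairingCLM_apply {V : Submodule ℂ (Fin g → ℂ)} (v : V) (B : perpIn μ W) :
    pairingCLM μ W V v B = (μ B : Matrix (Fin g) (Fin g) ℂ) *ᵥ (v : Fin g → ℂ) := rfl

theorem disjoint_range_of_projection {Q : Matrix (Fin g) (Fin g) ℂ}
    (hQ : ∀ w ∈ W, Q *ᵥ w = 0) (hQ' : ∀ v, v - Q *ᵥ v ∈ W) {v : Fin g → ℂ}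
    (hv : v ∈ LinearMap.range Q.mulVecLin) (hvW : v ∈ W) : v = 0 := by
  obtain ⟨u, rfl⟩ := hv
  have h1 := hQ _ (hQ' u)
  rw [mulVec_sub, sub_eq_zero] at h1
  simp only [mulVecLin_apply] at hvW ⊢
  rw [h1, hQ _ hvW]

theorem mulVec_of_mem_range_projection {Q : Matrix (Fin g) (Fin g) ℂ}
    (hQ : ∀ w ∈ W, Q *ᵥ w = 0) (hQ' : ∀ v, v - Q *ᵥ v ∈ W) {v : Fin g → ℂ}
    (hv : v ∈ LinearMap.range Q.mulVecLin) : Q *ᵥ v = v := by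
  obtain ⟨u, rfl⟩ := hv
  have h1 := hQ _ (hQ' u)
  rw [mulVec_sub, sub_eq_zero] at h1
  exact h1.symm

/-- A subspace of the same dimension as `W` which is annihilated by a space of matrices
projecting onto `perp W` is a graph over `W`. -/
theorem exists_add_mem_of_projection_surjective {Q : Matrix (Fin g) (Fin g) ℂ}
    (hQ : ∀ w ∈ W, Q *ᵥ w = 0) (hQ' : ∀ v, v - Q *ᵥ v ∈ W)
    {W' : Submodule ℂ (Fin g → ℂ)} (hfin : Module.finrank ℂ W' = Module.finrank ℂ W)
    (hW' : ∀ B ∈ perp W, ∃ M ∈ perp W', Qᵀ * (M : Matrix (Fin g) (Fin g) ℂ) * Q = B)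
    {w : Fin g → ℂ} (hw : w ∈ W) :
    ∃ v ∈ LinearMap.range Q.mulVecLin, w + v ∈ W' := by
  -- The projection to `W` along `range Q`. If `u ∈ W'` satisfies `u = Q u`, then `B u = Qᵀ M Q u =
  -- Qᵀ M u = 0` for every `B ∈ perp W`, so `u ∈ W ∩ range Q = 0`; equal dimensions then give
  -- surjectivity.
  let f : W' →ₗ[ℂ] W := (LinearMap.codRestrict W (LinearMap.id - Q.mulVecLin) hQ') ∘ₗ W'.subtype
  have hf : ∀ u : W', ((f u : W) : Fin g → ℂ) = u - Q *ᵥ u := fun u => rfl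
  have hinj : Function.Injective f := by
    rw [injective_iff_map_eq_zero]
    intro u hu
    have hu' : (u : Fin g → ℂ) = Q *ᵥ u := by
      have := hf u
      rw [hu] at this
      exact sub_eq_zero.1 this.symm
    have huW : (u : Fin g → ℂ) ∈ W := by
      refine mem_of_forall_mem_perp fun B hB => ?_
      obtain ⟨M, hM, hMB⟩ := hW' B hB
      rw [← hMB, ← mulVec_mulVec, ← mulVec_mulVec, ← hu', hM _ u.2, mulVec_zero]
    exact Subtype.ext (disjoint_range_of_projection hQ hQ' ⟨u, hu'.symm⟩ huW)
  obtain ⟨u, hu⟩ := (LinearMap.injective_iff_surjective_of_finrank_eq_finrank hfin).1 hinj ⟨w, hw⟩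
  refine ⟨Q *ᵥ u, ⟨u, rfl⟩, ?_⟩
  have := hf u
  rw [hu] at this
  change w = _ at this
  rw [this, sub_add_cancel]
  exact u.2

/-- The analytic core: the graph coordinate `l` of `W' s` over `W` has zero derivative by symmetry
of the second derivative of `Qᵀ A(s) w`. Once `W ≤ W' s`, the derivative of `A(s) w` vanishes too.
-/
theorem eq_of_fderiv_mem_perp (hg : Module.finrank ℂ W + 2 ≤ g) {Q : Matrix (Fin g) (Fin g) ℂ}
    (hQ : ∀ w ∈ W, Q *ᵥ w = 0) (hQ' : ∀ v, v - Q *ᵥ v ∈ W) {p : E →L[ℂ] perpIn μ W}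
    (hp : ∀ M, (μ (p M) : Matrix (Fin g) (Fin g) ℂ) = Qᵀ * μ M * Q)
    {s₀ : perpIn μ W} {ε : ℝ} {A : perpIn μ W → E}
    (hA : AnalyticOnNhd ℂ A (Metric.ball s₀ ε)) (hpA : ∀ s ∈ Metric.ball s₀ ε, p (A s) = s)
    {W' : perpIn μ W → Submodule ℂ (Fin g → ℂ)}
    (hfin : ∀ s ∈ Metric.ball s₀ ε, Module.finrank ℂ (W' s) = Module.finrank ℂ W)
    (hW' : ∀ s ∈ Metric.ball s₀ ε, ∀ B, fderiv ℂ A s B ∈ perpIn μ (W' s)) (hW₀ : W' s₀ = W)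
    {s : perpIn μ W} (hs : s ∈ Metric.ball s₀ ε) : W' s = W ∧ A s - A s₀ ∈ perpIn μ W := by
  have hs₀ : s₀ ∈ Metric.ball s₀ ε := Metric.mem_ball_self (Metric.pos_of_mem_ball hs)
  have hconn : IsPreconnected (Metric.ball s₀ ε) := (convex_ball s₀ ε).isPreconnected
  have hpd : ∀ s ∈ Metric.ball s₀ ε, ∀ B, p (fderiv ℂ A s B) = B := by
    intro s hs B
    have h1 : HasFDerivAt (fun s => p (A s)) (p.comp (fderiv ℂ A s)) s :=
      p.hasFDerivAt.comp s (hA s hs).differentiableAt.hasFDerivAt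
    have h2 : (fun s => p (A s)) =ᶠ[𝓝 s] id := by
      filter_upwards [Metric.isOpen_ball.mem_nhds hs] with t ht using hpA t ht
    exact DFunLike.congr_fun ((h1.congr_of_eventuallyEq h2.symm).unique (hasFDerivAt_id s)) B
  have hle : ∀ s ∈ Metric.ball s₀ ε, W ≤ W' s := by
    intro s hs w hw
    let V := LinearMap.range Q.mulVecLin
    let J := pairingCLM μ W V
    have hJ : LinearMap.ker (J : V →ₗ[ℂ] (perpIn μ W →L[ℂ] (Fin g → ℂ))) = ⊥ := by
      refine (LinearMap.ker_eq_bot').2 fun v hv => Subtype.ext ?_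
      refine disjoint_range_of_projection hQ hQ' v.2 (mem_of_forall_mem_perp fun B hB => ?_)
      simpa [J, pairingCLM_apply] using
        DFunLike.congr_fun hv (⟨μ.symm B, by simpa using hB⟩ : perpIn μ W)
    obtain ⟨G₀, hG₀⟩ := LinearMap.exists_leftInverse_of_injective _ hJ
    let G : (perpIn μ W →L[ℂ] (Fin g → ℂ)) →L[ℂ] V := LinearMap.toContinuousLinearMap G₀
    have hG : ∀ v, G (J v) = v := fun v => LinearMap.congr_fun hG₀ v
    let q : E →L[ℂ] (Fin g → ℂ) :=
      (LinearMap.toContinuousLinearMap Qᵀ.mulVecLin).comp (evalCLM μ w)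
    let β : perpIn μ W → Fin g → ℂ := fun t => q (A t)
    have hβ : AnalyticOnNhd ℂ β (Metric.ball s₀ ε) := fun t ht =>
      (q.analyticAt _).comp (hA t ht)
    -- `W'` carries no regularity assumption. Recovering `l` from `dβ` through a left inverse of the
    -- pairing makes it analytic.
    let l : perpIn μ W → V := fun t => -G (fderiv ℂ β t)
    have hl : AnalyticOnNhd ℂ l (Metric.ball s₀ ε) := fun t ht =>
      ((G.analyticAt _).comp (hβ t ht).fderiv).neg
    have hlβ : ∀ t ∈ Metric.ball s₀ ε, fderiv ℂ β t = -J (l t) ∧ w + (l t : Fin g → ℂ) ∈ W' t := by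
      intro t ht
      obtain ⟨v, hv, hwv⟩ := exists_add_mem_of_projection_surjective hQ hQ' (hfin t ht)
        (fun B hB => ⟨_, hW' t ht ⟨μ.symm B, by simpa using hB⟩, by
          refine (hp _).symm.trans ?_
          rw [hpd t ht]
          simp⟩) hw
      have hd : fderiv ℂ β t = -J ⟨v, hv⟩ := by
        have : fderiv ℂ β t = q.comp (fderiv ℂ A t) :=
          (q.hasFDerivAt.comp t (hA t ht).differentiableAt.hasFDerivAt).fderiv
        rw [this]
        ext B : 1
        have h1 : (μ (fderiv ℂ A t B) : Matrix (Fin g) (Fin g) ℂ) *ᵥ (w + v) = 0 :=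
          hW' t ht B _ hwv
        rw [mulVec_add, add_eq_zero_iff_eq_neg] at h1
        have h2 := hp (fderiv ℂ A t B)
        rw [hpd t ht] at h2
        change Qᵀ *ᵥ ((μ (fderiv ℂ A t B) : Matrix (Fin g) (Fin g) ℂ) *ᵥ w) =
          -((μ B : Matrix (Fin g) (Fin g) ℂ) *ᵥ v)
        rw [h1, h2, ← mulVec_mulVec, ← mulVec_mulVec, mulVec_of_mem_range_projection hQ hQ' hv,
          mulVec_neg]
      have hlt : l t = ⟨v, hv⟩ := by
        simp only [l]
        rw [hd, map_neg, hG, neg_neg]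
      rw [hlt]
      exact ⟨hd, hwv⟩
    have hl' : ∀ t ∈ Metric.ball s₀ ε, fderiv ℂ l t = 0 := by
      intro t ht
      have hsymm := pairing_fderiv_comm J (hβ t ht) (hl t ht) (by
        filter_upwards [Metric.isOpen_ball.mem_nhds ht] with u hu using (hlβ u hu).1)
      ext C : 1
      refine Subtype.ext (disjoint_range_of_projection hQ hQ' (fderiv ℂ l t C).2 ?_)
      have hcomm := mem_of_forall_mulVec_comm hg (fun C : perp W =>
        (fderiv ℂ l t ⟨μ.symm C, by simp⟩ : Fin g → ℂ)) (fun B C => by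
          have := hsymm ⟨μ.symm B, by simp⟩ ⟨μ.symm C, by simp⟩
          simpa [J, pairingCLM_apply] using this) ⟨μ C, C.2⟩
      simpa using hcomm
    have hls : l s = l s₀ :=
      Metric.isOpen_ball.is_const_of_fderiv_eq_zero hconn
        (fun t ht => (hl t ht).differentiableAt.differentiableWithinAt) hl' hs hs₀
    have hl₀ : (l s₀ : Fin g → ℂ) = 0 := by
      refine disjoint_range_of_projection hQ hQ' (l s₀).2 ?_
      have := (hlβ s₀ hs₀).2
      rw [hW₀] at this
      exact (Submodule.add_mem_iff_right _ hw).1 this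
    have := (hlβ s hs).2
    rwa [hls, hl₀, add_zero] at this
  refine ⟨(Submodule.eq_of_le_of_finrank_eq (hle s hs) (hfin s hs).symm).symm, fun w hw => ?_⟩
  have hd : ∀ t ∈ Metric.ball s₀ ε, fderiv ℂ (fun t => evalCLM μ w (A t)) t = 0 := by
    intro t ht
    have : fderiv ℂ (fun t => evalCLM μ w (A t)) t = (evalCLM μ w).comp (fderiv ℂ A t) :=
      ((evalCLM μ w).hasFDerivAt.comp t (hA t ht).differentiableAt.hasFDerivAt).fderiv
    rw [this]
    ext B : 1
    exact hW' t ht B w (hle t ht hw)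
  have := Metric.isOpen_ball.is_const_of_fderiv_eq_zero hconn (fun t ht =>
    ((evalCLM μ w).differentiableAt.comp t (hA t ht).differentiableAt).differentiableWithinAt)
    hd hs hs₀
  rw [map_sub, Submodule.coe_sub, sub_mulVec, sub_eq_zero]
  exact this

end LocalConstancy

/-! ### From local pieces to the whole slice. -/

section Slices

open Matrix

variable {g : ℕ} {E : Type*} [NormedAddCommGroup E] [NormedSpace ℂ E] [FiniteDimensional ℂ E]
  {μ : E ≃ₗ[ℂ] symMatrices g}

/-- Near a smooth point, `X` is an open piece of an affine space with constant `W`. -/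
theorem eventually_mem_iff_sub_mem_perp {X : Set E} {d : ℕ} (hd : d + 2 ≤ g)
    {W : E → Submodule ℂ (Fin g → ℂ)}
    (hW : ∀ A T, IsSmoothPointWithTangent X A T →
      Module.finrank ℂ (W A) = d ∧ T = perpIn μ (W A)) {a : E} (ha : a ∈ smoothLocus X) :
    (∀ᶠ x in 𝓝 a, x ∈ X → W x = W a ∧ x - a ∈ perpIn μ (W a)) ∧
      ∀ᶠ x in 𝓝 a, x - a ∈ perpIn μ (W a) → x ∈ X := by
  obtain ⟨T, hT⟩ := ha
  obtain ⟨hfin, hTW⟩ := hW a T hT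
  obtain ⟨haX, m, F, hF, hXF, hs, hTF⟩ := isSmoothPointWithTangent_iff.1 hT
  obtain ⟨Q, hQ, hQ'⟩ := exists_projection_matrix (W a)
  obtain ⟨p₀, hp₀, hp₀W, hp₀k⟩ := exists_projection_perp hQ hQ'
  let p : E →L[ℂ] perpIn μ (W a) := LinearMap.toContinuousLinearMap
    (LinearMap.codRestrict (perpIn μ (W a))
      (μ.symm.toLinearMap ∘ₗ p₀ ∘ₗ μ.toLinearMap) fun M => by simpa using hp₀W (μ M))
  have hpM : ∀ M, ((p M : perpIn μ (W a)) : E) = μ.symm (p₀ (μ M)) := fun M => rfl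
  have hp : ∀ k : perpIn μ (W a), p k = k := fun k => Subtype.ext (by
    rw [hpM, hp₀k (μ k) k.2, μ.symm_apply_apply])
  have hpQ : ∀ M, (μ (p M) : Matrix (Fin g) (Fin g) ℂ) = Qᵀ * μ M * Q := fun M => by
    rw [hpM, μ.apply_symm_apply, hp₀]
  have hFa : F a = 0 := hXF.self_of_nhds.1 haX
  obtain ⟨Ψ, hΨ, hΨa, hFΨ, hΨp, hsurj⟩ :=
    exists_analytic_section hF hFa hs (hTW.symm.trans hTF) p hp
  have hgood : ∀ᶠ x in 𝓝 a, AnalyticAt ℂ F x ∧ (∀ᶠ y in 𝓝 x, y ∈ X ↔ F y = 0) ∧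
      Function.Surjective ((fderiv ℂ F x).prod p) := by
    filter_upwards [hF.eventually_analyticAt, eventually_eventually_nhds.2 hXF, hsurj]
      with x h1 h2 h3 using ⟨h1, h2, h3⟩
  have hball := hΨ.eventually_analyticAt.and
    ((eventually_eventually_nhds.2 hFΨ).and
      (hΨ.continuousAt.eventually (by rw [hΨa]; exact hgood)))
  obtain ⟨ε, hε, hball⟩ := Metric.eventually_nhds_iff_ball.1 hball
  have hmem : ∀ s ∈ Metric.ball (p a) ε, Ψ s ∈ X := fun s hs => by
    obtain ⟨-, h1, -, h2, -⟩ := hball s hs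
    exact h2.self_of_nhds.2 h1.self_of_nhds.1
  have hsm : ∀ s ∈ Metric.ball (p a) ε, IsSmoothPointWithTangent X (Ψ s)
      (LinearMap.ker (fderiv ℂ F (Ψ s) : E →ₗ[ℂ] (Fin m → ℂ))) := fun s hs => by
    obtain ⟨-, -, h1, h2, h3⟩ := hball s hs
    refine isSmoothPointWithTangent_iff.2 ⟨hmem s hs, m, F, h1, h2, fun y => ?_, rfl⟩
    obtain ⟨x, hx⟩ := h3 (y, 0)
    exact ⟨x, congrArg Prod.fst hx⟩
  have hder : ∀ s ∈ Metric.ball (p a) ε, ∀ B, fderiv ℂ Ψ s B ∈ perpIn μ (W (Ψ s)) := by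
    intro s hs B
    rw [← (hW _ _ (hsm s hs)).2]
    obtain ⟨h0, h1, h2, -⟩ := hball s hs
    have h3 : HasFDerivAt (F ∘ Ψ) ((fderiv ℂ F (Ψ s)).comp (fderiv ℂ Ψ s)) s :=
      h2.differentiableAt.hasFDerivAt.comp s h0.differentiableAt.hasFDerivAt
    have h4 : F ∘ Ψ =ᶠ[𝓝 s] fun _ => 0 := h1.mono fun _ h => h.1
    exact DFunLike.congr_fun
      ((h3.congr_of_eventuallyEq h4.symm).unique (hasFDerivAt_const 0 s)) B
  have hmain : ∀ s ∈ Metric.ball (p a) ε, W (Ψ s) = W a ∧ Ψ s - a ∈ perpIn μ (W a) := by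
    intro s hs
    have := eq_of_fderiv_mem_perp (W' := fun s => W (Ψ s)) (by omega) hQ hQ' hpQ
      (fun s hs => (hball s hs).1) (fun s hs => (hball s hs).2.1.self_of_nhds.2)
      (fun s hs => ((hW _ _ (hsm s hs)).1.trans hfin.symm)) hder (by rw [hΨa]) hs
    rwa [hΨa] at this
  have hpa := (p.continuous.tendsto a).eventually (Metric.ball_mem_nhds (p a) hε)
  constructor
  · filter_upwards [hXF, hΨp, hpa] with x h1 h2 h3 hx
    have := hmain _ h3
    rwa [h2 (h1.1 hx)] at this
  -- `Ψ (p x) - a` and `x - a` both lie in `perp (W a)` and have the same image under `p`, so `x = Ψ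
  -- (p x)`.
  · filter_upwards [hpa] with x h1 hx
    have h2 := hp ⟨_, (hmain _ h1).2⟩
    have h3 := hp ⟨_, hx⟩
    rw [map_sub, (hball _ h1).2.1.self_of_nhds.2] at h2
    rw [map_sub, h2] at h3
    have h4 : Ψ (p x) - a = x - a := congrArg Subtype.val h3
    rw [← sub_left_injective h4]
    exact hmem _ h1

theorem smul_add_smul_mem_siegelSpace {M N : symMatrices g} (hM : M ∈ siegelSpace g)
    (hN : N ∈ siegelSpace g) {r : ℝ} (h0 : 0 ≤ r) (h1 : r ≤ 1) :
    M + (r : ℂ) • (N - M) ∈ siegelSpace g := by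
  have heq : ((M + (r : ℂ) • (N - M) : symMatrices g) : Matrix (Fin g) (Fin g) ℂ).map Complex.im =
      (1 - r) • (M : Matrix (Fin g) (Fin g) ℂ).map Complex.im +
        r • (N : Matrix (Fin g) (Fin g) ℂ).map Complex.im := by
    ext i j
    simp
    ring
  change Matrix.PosDef _
  rw [heq]
  rcases h1.eq_or_lt with rfl | h1
  · simpa using show PosDef _ from hN
  rcases h0.eq_or_lt with rfl | h0
  · simpa using show PosDef _ from hM
  exact (hM.smul (sub_pos.2 h1)).add (hN.smul h0)

theorem exists_eq_slice {X : Set E} {d : ℕ} (hd : d + 2 ≤ g)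
    (hX : IsSubvariety (μ ⁻¹' siegelSpace g) X) {W : E → Submodule ℂ (Fin g → ℂ)}
    (hW : ∀ A T, IsSmoothPointWithTangent X A T →
      Module.finrank ℂ (W A) = d ∧ T = perpIn μ (W A)) :
    ∃ W₀ : Submodule ℂ (Fin g → ℂ), (∀ A ∈ smoothLocus X, W A = W₀) ∧
      ∃ τ ∈ siegelSpace g, X = μ ⁻¹' slice W₀ τ := by
  obtain ⟨τ, hτ⟩ := hX.2.nonempty
  have hτX : τ ∈ X := by
    obtain ⟨T, hT⟩ := hτ
    exact hT.1
  have hconst : ∀ x ∈ smoothLocus X, W x = W τ ∧ x - τ ∈ perpIn μ (W τ) := fun x hx => by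
    -- Having the same `W` and the same class modulo `perp W` is an equivalence relation that holds
    -- locally, hence holds throughout a connected set.
    refine hX.2.isPreconnected.induction₂ (fun y z => W z = W y ∧ z - y ∈ perpIn μ (W y))
      (fun y hy => ?_) ?_ ?_ hτ hx
    · filter_upwards [nhdsWithin_le_nhds (eventually_mem_iff_sub_mem_perp hd hW hy).1,
        self_mem_nhdsWithin] with z h1 h2
      obtain ⟨T, hT⟩ := h2
      exact h1 hT.1
    · rintro x y z - - - ⟨h1, h2⟩ ⟨h3, h4⟩
      rw [h1] at h3 h4
      exact ⟨h3, by simpa using add_mem h4 h2⟩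
    · rintro x y - - ⟨h1, h2⟩
      rw [h1]
      exact ⟨rfl, by simpa using neg_mem h2⟩
  refine ⟨W τ, fun x hx => (hconst x hx).1, μ τ, hX.1.1 hτX, Set.Subset.antisymm ?_ ?_⟩
  · refine fun x hx => ⟨hX.1.1 hx, fun w hw => ?_⟩
    have hcl : IsClosed {y | evalCLM μ w y = evalCLM μ w τ} :=
      isClosed_eq (evalCLM μ w).continuous continuous_const
    refine closure_minimal (fun y hy => ?_) hcl (hX.1.subset_closure_smoothLocus hx)
    have h1 : (μ (y - τ) : Matrix (Fin g) (Fin g) ℂ) *ᵥ w = 0 := (hconst y hy).2 w hw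
    rwa [← evalCLM_apply, map_sub, sub_eq_zero] at h1
  · rintro x ⟨hxH, hx⟩
    have hmem : x - τ ∈ perpIn μ (W τ) := fun w hw => by
      change (μ (x - τ) : Matrix (Fin g) (Fin g) ℂ) *ᵥ w = 0
      rw [← evalCLM_apply, map_sub, sub_eq_zero]
      exact hx w hw
    have := hX.1.mem_of_eventually_mem (a := τ) (v := x - τ) ?_ ?_
    · simpa using this
    · rintro t ht
      rw [segment_eq_image] at ht
      obtain ⟨r, ⟨h0, h1⟩, rfl⟩ := ht
      have hr : (1 - r) • (0 : ℂ) + r • (1 : ℂ) = r := by simp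
      have := smul_add_smul_mem_siegelSpace (hX.1.1 hτX) hxH h0 h1
      rwa [← map_sub, ← map_smul, ← map_add, ← hr] at this
    · have hc : Tendsto (fun t : ℂ => τ + t • (x - τ)) (𝓝 0) (𝓝 τ) := by
        have : Continuous fun t : ℂ => τ + t • (x - τ) := by fun_prop
        simpa using this.tendsto 0
      filter_upwards [hc.eventually (eventually_mem_iff_sub_mem_perp hd hW hτ).2] with t ht
      exact ht (by simpa using Submodule.smul_mem _ t hmem)

end Slices
end SiegelSlice

theorem mainTheorem5 (g i : ℕ) (hi : 3 ≤ i)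
    (X : Set (symMatrices g))
    (hX : IsSubvariety (siegelSpace g) X)
    (hdim : HasDimension X (i * (i - 1) / 2))
    (W : symMatrices g → Submodule ℂ (Fin g → ℂ))
    (hW : ∀ A T, IsSmoothPointWithTangent X A T →
      Module.finrank ℂ (W A) + i = g + 1 ∧ T = perp (W A)) :
    ∃ W₀ : Submodule ℂ (Fin g → ℂ),
      (∀ A ∈ smoothLocus X, W A = W₀) ∧
      ∃ τ ∈ siegelSpace g, X = slice W₀ τ := by
  obtain ⟨A, T, hT⟩ := hX.2.nonempty
  -- A smooth point exists, so `i ≤ g + 1`: the subtraction in `g + 1 - i` is not truncated, and `3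
  -- ≤ i` becomes codimension at least two.
  have hA := (hW A T hT).1
  exact exists_eq_slice (d := g + 1 - i) (by omega) (μ := LinearEquiv.refl ℂ (symMatrices g)) hX
    fun A T h => ⟨by have := (hW A T h).1; omega, (hW A T h).2⟩
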